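/- All Banach lattices are real. For a Banach lattice $E$, the dual $E'$ is ordered by $f\le g$ iff $f(x)\le g(x)$ for all $x\ge 0$ in $E$, and is then a Banach lattice. A sequence $(f_k)\subset E'$ is disjoint if $|f_k|\wedge|f_j|=0$ in $E'$ whenever $k\ne j$. The Banach lattice $E$ has property (d) if $|f_k|\to 0$ in the weak* topology for every disjoint weak* null sequence $(f_k)\subset E'$. For a sequence $(E_n)_{n\in\mathbb N}$ of Banach lattices let $$\Big(\bigoplus_{n} E_n\Big)_0=\{(x_n)_n : x_n\in E_n,\ \lim_n\|x_n\|=0\},\qquad \Big(\bigoplus_{n} E_n\Big)_p=\Big\{(x_n)_n : x_n\in E_n,\ \sum_n\|x_n\|^p<\infty\Big\}\quad(1\le p<\infty),$$ which are Banach lattices for the coordinatewise order with the supremum norm, respectively the $p$-norm. When $E_n=E$ for all $n$, they are denoted by $c_0(E)$ and $\ell_p(E)$. (1) For every sequence $(E_n)_{n\in\mathbb N}$ of Banach lattices, $(\bigoplus_n E_n)_0$ has property (d) if and only if $E_n$ has property (d) for all $n$. (2) For every sequence $(E_n)_{n\in\mathbb N}$ of Banach lattices and every $1\le p<\infty$,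 $(\bigoplus_n E_n)_p$ has property (d) if and only if $E_n$ has property (d) for all $n$. (3) For every Banach lattice $E$, the following are equivalent: (a) $E$ has property (d); (b) $c_0(E)$ has property (d); (c) $\ell_p(E)$ has property (d) for some $1\le p<\infty$; (d) $\ell_p(E)$ has property (d) for all $1\le p<\infty$. -/

import Mathlib

open Filter Topology
open scoped ENNReal

/-! Banach lattices are handled unbundled: a real normed space with a lattice order, carrying
`IsOrderedAddMonoid`, `IsOrderedModule ℝ`, `HasSolidNorm` and `CompleteSpace`. -/

/-! ### The dual Banach lattice -/

section Dual

variable {E : Type*} [NormedAddCommGroup E] [NormedSpace ℝ E] [Lattice E] [HasSolidNorm E]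
  [IsOrderedAddMonoid E]

theorem le_norm_mul_of_mem_Icc (f : StrongDual ℝ E) {x y : E} (hy : y ∈ Set.Icc 0 x) :
    f y ≤ ‖f‖ * ‖x‖ := by
  refine (le_abs_self _).trans ((f.le_opNorm y).trans ?_)
  refine mul_le_mul_of_nonneg_left ?_ (norm_nonneg f)
  refine norm_le_norm_of_abs_le_abs ?_
  rw [abs_of_nonneg hy.1, abs_of_nonneg (hy.1.trans hy.2)]
  exact hy.2

theorem bddAbove_image_Icc (f : StrongDual ℝ E) (x : E) : BddAbove (f '' Set.Icc 0 x) := by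
  refine ⟨‖f‖ * ‖x‖, ?_⟩
  rintro _ ⟨y, hy, rfl⟩
  exact le_norm_mul_of_mem_Icc f hy

/-- The Riesz–Kantorovich formula for the positive part of a functional, on the positive cone:
`f⁺(x) = sup {f(y) : 0 ≤ y ≤ x}` for `x ≥ 0`. -/
noncomputable def dualPosAux (f : StrongDual ℝ E) (x : E) : ℝ := sSup (f '' Set.Icc 0 x)

theorem le_dualPosAux (f : StrongDual ℝ E) {x y : E} (hy : y ∈ Set.Icc 0 x) :
    f y ≤ dualPosAux f x :=
  le_csSup (bddAbove_image_Icc f x) ⟨y, hy, rfl⟩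

theorem dualPosAux_le (f : StrongDual ℝ E) {x : E} (hx : 0 ≤ x) {c : ℝ}
    (h : ∀ y ∈ Set.Icc 0 x, f y ≤ c) : dualPosAux f x ≤ c := by
  refine csSup_le ⟨f 0, 0, ⟨le_rfl, hx⟩, rfl⟩ ?_
  rintro _ ⟨y, hy, rfl⟩
  exact h y hy

theorem dualPosAux_nonneg (f : StrongDual ℝ E) {x : E} (hx : 0 ≤ x) : 0 ≤ dualPosAux f x := by
  simpa using le_dualPosAux f (x := x) (y := 0) ⟨le_rfl, hx⟩

theorem dualPosAux_add (f : StrongDual ℝ E) {x y : E} (hx : 0 ≤ x) (hy : 0 ≤ y) :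
    dualPosAux f (x + y) = dualPosAux f x + dualPosAux f y := by
  apply le_antisymm
  · refine dualPosAux_le f (add_nonneg hx hy) fun z hz => ?_
    have h1 : f (z ⊓ x) ≤ dualPosAux f x := le_dualPosAux f ⟨le_inf hz.1 hx, inf_le_right⟩
    have h2 : f (z - z ⊓ x) ≤ dualPosAux f y := by
      refine le_dualPosAux f ⟨sub_nonneg.2 inf_le_left, ?_⟩
      rw [sub_le_iff_le_add, add_inf]
      exact le_inf (le_add_of_nonneg_left hy) (by rw [add_comm]; exact hz.2)
    have h3 : f z = f (z ⊓ x) + f (z - z ⊓ x) := by rw [← map_add]; congr 1; abel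
    linarith
  · have key : ∀ z ∈ Set.Icc 0 x, f z ≤ dualPosAux f (x + y) - dualPosAux f y := by
      intro z hz
      have : dualPosAux f y ≤ dualPosAux f (x + y) - f z := by
        refine dualPosAux_le f hy fun w hw => ?_
        have := le_dualPosAux f (x := x + y) (y := z + w)
          ⟨add_nonneg hz.1 hw.1, add_le_add hz.2 hw.2⟩
        rw [map_add] at this
        linarith
      linarith
    linarith [dualPosAux_le f hx key]

theorem dualPosAux_sub_eq (f : StrongDual ℝ E) {x a b : E} (ha : 0 ≤ a) (hb : 0 ≤ b)
    (h : x = a - b) :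
    dualPosAux f x⁺ - dualPosAux f x⁻ = dualPosAux f a - dualPosAux f b := by
  have h1 : x⁺ + b = a + x⁻ := by
    have := posPart_sub_negPart x
    rw [h] at this ⊢
    rw [sub_eq_sub_iff_add_eq_add] at this
    exact this
  have h2 := dualPosAux_add f (posPart_nonneg x) hb
  have h3 := dualPosAux_add f ha (negPart_nonneg x)
  rw [h1] at h2
  linarith

/-- The positive part `f⁺` of a continuous functional on a normed vector lattice: the linear
extension `x ↦ f⁺(x⁺) - f⁺(x⁻)` of the Riesz–Kantorovich formula. -/
noncomputable def dualPos (f : StrongDual ℝ E) : StrongDual ℝ E :=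
  AddMonoidHom.toRealLinearMap
    (AddMonoidHom.mk' (fun x : E => dualPosAux f x⁺ - dualPosAux f x⁻) (by
      intro x y
      rw [dualPosAux_sub_eq f (x := x + y) (a := x⁺ + y⁺) (b := x⁻ + y⁻)
          (add_nonneg (posPart_nonneg x) (posPart_nonneg y))
          (add_nonneg (negPart_nonneg x) (negPart_nonneg y))
          (by conv_lhs => rw [← posPart_sub_negPart x, ← posPart_sub_negPart y]
              abel),
        dualPosAux_add f (posPart_nonneg x) (posPart_nonneg y),
        dualPosAux_add f (negPart_nonneg x) (negPart_nonneg y)]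
      ring))
    (by
      refine AddMonoidHomClass.continuous_of_bound _ (‖f‖ : ℝ) fun x => ?_
      have hp : dualPosAux f x⁺ ≤ ‖f‖ * ‖x‖ := by
        refine dualPosAux_le f (posPart_nonneg x) fun y hy => ?_
        have h := le_norm_mul_of_mem_Icc f (x := |x|)
          ⟨hy.1, hy.2.trans (sup_le (le_abs_self x) (abs_nonneg x))⟩
        rwa [norm_abs_eq_norm] at h
      have hn : dualPosAux f x⁻ ≤ ‖f‖ * ‖x‖ := by
        refine dualPosAux_le f (negPart_nonneg x) fun y hy => ?_
        have h := le_norm_mul_of_mem_Icc f (x := |x|)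
          ⟨hy.1, hy.2.trans (sup_le (neg_le_abs x) (abs_nonneg x))⟩
        rwa [norm_abs_eq_norm] at h
      have hp0 := dualPosAux_nonneg f (posPart_nonneg x)
      have hn0 := dualPosAux_nonneg f (negPart_nonneg x)
      simp only [AddMonoidHom.mk'_apply, Real.norm_eq_abs]
      rw [abs_le]
      constructor <;> linarith)

theorem dualPos_apply (f : StrongDual ℝ E) (x : E) :
    dualPos f x = dualPosAux f x⁺ - dualPosAux f x⁻ := rfl

theorem dualPos_apply_of_nonneg (f : StrongDual ℝ E) {x : E} (hx : 0 ≤ x) :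
    dualPos f x = sSup (f '' Set.Icc 0 x) := by
  have := dualPosAux_sub_eq f hx le_rfl (sub_zero x).symm
  have h0 : dualPosAux f (0 : E) = 0 := by simp [dualPosAux]
  rw [h0, sub_zero] at this
  exact this

/-- The order of the dual `E'`: `f ≤ g` iff `f x ≤ g x` for all `x ≥ 0`. (It is not a global
instance, because Mathlib already orders the operators on a Hilbert space.) -/
@[reducible] def dualPartialOrder (E : Type*) [NormedAddCommGroup E] [NormedSpace ℝ E] [Lattice E]
    [HasSolidNorm E] [IsOrderedAddMonoid E] : PartialOrder (StrongDual ℝ E) where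
  le f g := ∀ x : E, 0 ≤ x → f x ≤ g x
  le_refl _ _ _ := le_rfl
  le_trans _ _ _ h1 h2 x hx := (h1 x hx).trans (h2 x hx)
  le_antisymm f g h1 h2 := by
    ext x
    have hp := le_antisymm (h1 _ (posPart_nonneg x)) (h2 _ (posPart_nonneg x))
    have hn := le_antisymm (h1 _ (negPart_nonneg x)) (h2 _ (negPart_nonneg x))
    rw [← posPart_sub_negPart x, map_sub, map_sub, hp, hn]

theorem le_dualPos (f : StrongDual ℝ E) {x : E} (hx : 0 ≤ x) : f x ≤ dualPos f x := by
  rw [dualPos_apply_of_nonneg f hx]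
  exact le_dualPosAux f ⟨hx, le_rfl⟩

theorem dualPos_nonneg (f : StrongDual ℝ E) {x : E} (hx : 0 ≤ x) : 0 ≤ dualPos f x := by
  rw [dualPos_apply_of_nonneg f hx]
  exact dualPosAux_nonneg f hx

theorem dualPos_le {f g : StrongDual ℝ E} (hfg : ∀ x : E, 0 ≤ x → f x ≤ g x)
    (hg : ∀ x : E, 0 ≤ x → 0 ≤ g x) {x : E} (hx : 0 ≤ x) : dualPos f x ≤ g x := by
  rw [dualPos_apply_of_nonneg f hx]
  refine dualPosAux_le f hx fun y hy => (hfg y hy.1).trans ?_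
  have := hg (x - y) (sub_nonneg.2 hy.2)
  rw [map_sub] at this
  linarith

/-- The dual `E'` of a normed vector lattice is a vector lattice: `f ⊔ g = (f - g)⁺ + g` and
`f ⊓ g = f - (f - g)⁺`. In particular `|f| = f ⊔ -f` is the usual modulus of `f` in `E'`. -/
@[reducible] noncomputable def dualLattice (E : Type*) [NormedAddCommGroup E] [NormedSpace ℝ E]
    [Lattice E] [HasSolidNorm E] [IsOrderedAddMonoid E] : Lattice (StrongDual ℝ E) where
  __ := dualPartialOrder E
  sup f g := dualPos (f - g) + g
  inf f g := f - dualPos (f - g)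
  le_sup_left f g x hx := by
    have := le_dualPos (f - g) hx
    simp only [add_apply, sub_apply] at this ⊢
    linarith
  le_sup_right f g x hx := by
    have := dualPos_nonneg (f - g) hx
    simp only [add_apply] at this ⊢
    linarith
  sup_le f g k hf hg x hx := by
    have := dualPos_le (f := f - g) (g := k - g)
      (fun y hy => by simpa using hf y hy) (fun y hy => by simpa using hg y hy) hx
    simp only [add_apply, sub_apply] at this ⊢
    linarith
  inf_le_left f g x hx := by
    have := dualPos_nonneg (f - g) hx
    simp only [sub_apply] at this ⊢
    linarith
  inf_le_right f g x hx := by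
    have := le_dualPos (f - g) hx
    simp only [sub_apply] at this ⊢
    linarith
  le_inf k f g hf hg x hx := by
    have := dualPos_le (f := f - g) (g := f - k)
      (fun y hy => by
        have := hg y hy
        simp only [sub_apply]
        linarith) (fun y hy => by simpa using hf y hy) hx
    simp only [sub_apply] at this ⊢
    linarith

attribute [local instance] dualLattice

/-- Property (d): `|f_n| → 0` weak* for every disjoint weak* null sequence `(f_n)` in `E'`, where
the modulus and the disjointness `|f_m| ⊓ |f_n| = 0` refer to the vector lattice `E'`. -/
def PropertyD (E : Type*) [NormedAddCommGroup E] [NormedSpace ℝ E] [Lattice E] [HasSolidNorm E]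
    [IsOrderedAddMonoid E] : Prop :=
  ∀ f : ℕ → StrongDual ℝ E,
    (Pairwise fun m n => |f m| ⊓ |f n| = 0) →
    Tendsto (fun n => StrongDual.toWeakDual (f n)) atTop (𝓝 0) →
    Tendsto (fun n => StrongDual.toWeakDual |f n|) atTop (𝓝 0)

end Dual

/-! ### `ℓ_p`-sums of Banach lattices -/

section LpSum

variable {ι : Type*} {E : ι → Type*} [∀ i, NormedAddCommGroup (E i)] [∀ i, Lattice (E i)]
  [∀ i, HasSolidNorm (E i)] [∀ i, IsOrderedAddMonoid (E i)] {p : ℝ≥0∞}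

theorem Memℓp.latticeSup {f g : ∀ i, E i} (hf : Memℓp f p) (hg : Memℓp g p) :
    Memℓp (f ⊔ g) p := by
  refine ((memℓp_norm_iff.2 hf).add (memℓp_norm_iff.2 hg)).mono fun i => ?_
  simpa using norm_sup_le_add (f i) (g i)

theorem Memℓp.latticeInf {f g : ∀ i, E i} (hf : Memℓp f p) (hg : Memℓp g p) :
    Memℓp (f ⊓ g) p := by
  refine ((memℓp_norm_iff.2 hf).add (memℓp_norm_iff.2 hg)).mono fun i => ?_
  simpa using norm_inf_le_add (f i) (g i)

/-- The coordinatewise order and lattice operations on an `ℓ_p`-sum of Banach lattices. -/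
instance lp.instLatticeSum : Lattice (lp E p) where
  le f g := ∀ i, f i ≤ g i
  le_refl _ _ := le_rfl
  le_trans _ _ _ h1 h2 i := (h1 i).trans (h2 i)
  le_antisymm _ _ h1 h2 := lp.ext (funext fun i => le_antisymm (h1 i) (h2 i))
  sup f g := ⟨fun i => f i ⊔ g i, (lp.memℓp f).latticeSup (lp.memℓp g)⟩
  inf f g := ⟨fun i => f i ⊓ g i, (lp.memℓp f).latticeInf (lp.memℓp g)⟩
  le_sup_left _ _ _ := le_sup_left
  le_sup_right _ _ _ := le_sup_right
  sup_le _ _ _ h1 h2 i := sup_le (h1 i) (h2 i)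
  inf_le_left _ _ _ := inf_le_left
  inf_le_right _ _ _ := inf_le_right
  le_inf _ _ _ h1 h2 i := le_inf (h1 i) (h2 i)

theorem lp.latticeSup_apply (f g : lp E p) (i : ι) : (f ⊔ g) i = f i ⊔ g i := rfl

theorem lp.latticeInf_apply (f g : lp E p) (i : ι) : (f ⊓ g) i = f i ⊓ g i := rfl

theorem lp.latticeAbs_apply (f : lp E p) (i : ι) : |f| i = |f i| := rfl

instance lp.instIsOrderedAddMonoidSum : IsOrderedAddMonoid (lp E p) where
  add_le_add_left _ _ h c i := add_le_add_left (h i) (c i)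

instance lp.instIsOrderedModuleSum [∀ i, NormedSpace ℝ (E i)] [∀ i, IsOrderedModule ℝ (E i)] :
    IsOrderedModule ℝ (lp E p) where
  smul_le_smul_of_nonneg_left _ ha _ _ h i := smul_le_smul_of_nonneg_left (h i) ha
  smul_le_smul_of_nonneg_right x hx _ _ h i :=
    smul_le_smul_of_nonneg_right (b := x i) h (hx i)

instance lp.instHasSolidNormSum [Fact (1 ≤ p)] : HasSolidNorm (lp E p) where
  solid _ _ h := lp.norm_mono (zero_lt_one.trans_le Fact.out).ne'
    fun i => norm_le_norm_of_abs_le_abs (h i)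

end LpSum

/-! ### `c_0`-sums of Banach lattices -/

section C0Sum

variable (E : ℕ → Type*) [∀ n, NormedAddCommGroup (E n)] [∀ n, NormedSpace ℝ (E n)]

/-- The `c_0`-direct sum of the spaces `E n`: all sequences `x` with `x n ∈ E n` and `‖x n‖ → 0`,
with the supremum norm (such sequences are bounded, so they form a subspace of the
`ℓ_∞`-sum, whose norm is the supremum norm). -/
def c0Sum : Submodule ℝ (lp E ∞) where
  carrier := {x | Tendsto (fun n => ‖x n‖) atTop (𝓝 0)}
  zero_mem' := by simp
  add_mem' {x y} hx hy := by
    refine squeeze_zero (fun _ => norm_nonneg _) (fun n => norm_add_le (x n) (y n)) ?_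
    simpa using Tendsto.add hx hy
  smul_mem' c x hx := by
    have : Tendsto (fun n => ‖c‖ * ‖x n‖) atTop (𝓝 0) := by simpa using Tendsto.const_mul ‖c‖ hx
    simpa [norm_smul] using this

variable {E}

theorem mem_c0Sum {x : lp E ∞} : x ∈ c0Sum E ↔ Tendsto (fun n => ‖x n‖) atTop (𝓝 0) := Iff.rfl

theorem exists_mem_c0Sum (x : ∀ n, E n) (hx : Tendsto (fun n => ‖x n‖) atTop (𝓝 0)) :
    ∃ y ∈ c0Sum E, ∀ n, y n = x n :=
  ⟨⟨x, memℓp_infty hx.bddAbove_range⟩, hx, fun _ => rfl⟩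

theorem isClosed_c0Sum : IsClosed (c0Sum E : Set (lp E ∞)) := by
  refine isClosed_of_closure_subset fun x hx => ?_
  refine Metric.tendsto_atTop.2 fun ε hε => ?_
  obtain ⟨y, hy, hxy⟩ := Metric.mem_closure_iff.1 hx (ε / 2) (half_pos hε)
  obtain ⟨N, hN⟩ := Metric.tendsto_atTop.1 (mem_c0Sum.1 hy) (ε / 2) (half_pos hε)
  refine ⟨N, fun n hn => ?_⟩
  have h1 := hN n hn
  have h2 : ‖x n - y n‖ ≤ ‖x - y‖ := lp.norm_apply_le_norm ENNReal.top_ne_zero (x - y) n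
  have h3 : ‖x n‖ ≤ ‖x n - y n‖ + ‖y n‖ := by
    simpa using norm_add_le (x n - y n) (y n)
  rw [dist_eq_norm] at hxy
  simp only [dist_zero_right, norm_norm] at h1 ⊢
  linarith

instance c0Sum.instCompleteSpace [∀ n, CompleteSpace (E n)] : CompleteSpace (c0Sum E) :=
  isClosed_c0Sum.completeSpace_coe

variable [∀ n, Lattice (E n)] [∀ n, HasSolidNorm (E n)] [∀ n, IsOrderedAddMonoid (E n)]

/-- The coordinatewise order and lattice operations on a `c_0`-sum of Banach lattices. -/
instance c0Sum.instLattice : Lattice (c0Sum E) :=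
  Subtype.lattice
    (fun x y hx hy => by
      refine squeeze_zero (fun _ => norm_nonneg _) (fun n => norm_sup_le_add (x n) (y n)) ?_
      simpa using Tendsto.add hx hy)
    (fun x y hx hy => by
      refine squeeze_zero (fun _ => norm_nonneg _) (fun n => norm_inf_le_add (x n) (y n)) ?_
      simpa using Tendsto.add hx hy)

instance c0Sum.instIsOrderedAddMonoid : IsOrderedAddMonoid (c0Sum E) where
  add_le_add_left _ _ h c := add_le_add_left (α := lp E ∞) h c.1

instance c0Sum.instIsOrderedModule [∀ n, IsOrderedModule ℝ (E n)] :
    IsOrderedModule ℝ (c0Sum E) where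
  smul_le_smul_of_nonneg_left _ ha _ _ h :=
    smul_le_smul_of_nonneg_left (β := lp E ∞) h ha
  smul_le_smul_of_nonneg_right x hx _ _ h :=
    smul_le_smul_of_nonneg_right (β := lp E ∞) (b := x.1) h hx

instance c0Sum.instHasSolidNorm : HasSolidNorm (c0Sum E) where
  solid _ _ h := HasSolidNorm.solid (α := lp E ∞) h

end C0Sum

/-! ### Weak* null sequences and norm bounds -/

section WeakStar

variable {X : Type*} [NormedAddCommGroup X] [NormedSpace ℝ X]

/-! Let `X` be either sum, with coordinate embeddings `i n` and projections `π n`. All of these are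
interval preserving: `T` maps `[0, x]` onto `[0, T x]`. By the Riesz–Kantorovich formula their
adjoints are lattice homomorphisms, hence preserve moduli and disjointness; they also preserve weak*
null sequences.

A sequence on a summand is therefore pulled back along `π n` and its moduli are recovered on the
range of `i n` (`PropertyD.of_retraction`). Conversely, restricting a sequence `f k` on `X` along `i
n` gives `|f k| (i n z) → 0` for all `n` and `z`. Since `x = ∑ i n (π n x)` and the `|f k|` are
uniformly bounded by Banach–Steinhaus, `|f k| x → 0` (`propertyD_iff_of_decomposition`). Convergence
of this series is where `p ≠ ∞`, or the `c_0` condition, enters. -/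

theorem tendsto_toWeakDual_zero_iff {f : ℕ → StrongDual ℝ X} :
    Tendsto (fun k => StrongDual.toWeakDual (f k)) atTop (𝓝 0) ↔
      ∀ x, Tendsto (fun k => f k x) atTop (𝓝 0) :=
  tendsto_iff_forall_eval_tendsto_topDualPairing

theorem exists_norm_le_of_tendsto_apply [CompleteSpace X] {f : ℕ → StrongDual ℝ X}
    (h : ∀ x, Tendsto (fun k => f k x) atTop (𝓝 0)) : ∃ C, ∀ k, ‖f k‖ ≤ C := by
  refine banach_steinhaus fun x => ?_
  obtain ⟨C, hC⟩ := (h x).norm.bddAbove_range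
  exact ⟨C, fun k => hC ⟨k, rfl⟩⟩

/-- A finite partial sum is handled termwise; the uniform bound controls the remainder for all `k`
at once. -/
theorem tendsto_apply_of_hasSum {g : ℕ → StrongDual ℝ X} {C : ℝ} (hC : ∀ k, ‖g k‖ ≤ C)
    {u : ℕ → X} {x : X} (hu : HasSum u x) (h : ∀ n, Tendsto (fun k => g k (u n)) atTop (𝓝 0)) :
    Tendsto (fun k => g k x) atTop (𝓝 0) := by
  have hC0 : 0 ≤ C := (norm_nonneg _).trans (hC 0)
  refine Metric.tendsto_atTop.2 fun ε hε => ?_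
  -- Dividing by `C + 1` rather than `C` covers `C = 0`.
  obtain ⟨s, hs⟩ := (Metric.tendsto_nhds.1 hu (ε / 2 / (C + 1)) (by positivity)).exists
  have hsum : Tendsto (fun k => g k (∑ n ∈ s, u n)) atTop (𝓝 0) := by
    simpa using tendsto_finsetSum s fun n _ => h n
  obtain ⟨N, hN⟩ := Metric.tendsto_atTop.1 hsum (ε / 2) (half_pos hε)
  refine ⟨N, fun k hk => ?_⟩
  have h1 := hN k hk
  rw [dist_zero_right] at h1 ⊢
  rw [dist_comm, dist_eq_norm, lt_div_iff₀ (by positivity)] at hs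
  have h2 : ‖g k (x - ∑ n ∈ s, u n)‖ ≤ C * ‖x - ∑ n ∈ s, u n‖ :=
    (g k).le_of_opNorm_le (hC k) _
  have h3 : ‖g k x‖ ≤ ‖g k (x - ∑ n ∈ s, u n)‖ + ‖g k (∑ n ∈ s, u n)‖ := by
    simpa using norm_add_le (g k (x - ∑ n ∈ s, u n)) (g k (∑ n ∈ s, u n))
  nlinarith [norm_nonneg (x - ∑ n ∈ s, u n)]

end WeakStar

/-! ### Order intervals and coordinate vectors -/

section LpSingle

variable {E : ℕ → Type*} [∀ n, NormedAddCommGroup (E n)] [∀ n, Lattice (E n)]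
  [∀ n, HasSolidNorm (E n)] [∀ n, IsOrderedAddMonoid (E n)]

theorem lp.single_le_of_le_apply {p : ℝ≥0∞} {n : ℕ} {z : E n} {x : lp E p} (hx : 0 ≤ x)
    (hz : z ≤ x n) : lp.single p n z ≤ x := by
  intro m
  rcases eq_or_ne m n with rfl | hm
  · rwa [lp.single_apply_self]
  · rw [lp.single_apply_ne p n z hm]
    exact hx m

theorem lp.single_nonneg {p : ℝ≥0∞} {n : ℕ} {z : E n} (hz : 0 ≤ z) : 0 ≤ lp.single p n z := by
  intro m
  rcases eq_or_ne m n with rfl | hm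
  · rwa [lp.single_apply_self]
  · rw [lp.single_apply_ne p n z hm]
    exact le_rfl

theorem lp.eq_single_of_mem_Icc {p : ℝ≥0∞} {n : ℕ} {z : E n} {x : lp E p}
    (hx : x ∈ Set.Icc 0 (lp.single p n z)) : lp.single p n (x n) = x := by
  refine lp.ext (funext fun m => ?_)
  rcases eq_or_ne m n with rfl | hm
  · rw [lp.single_apply_self]
  · rw [lp.single_apply_ne p n _ hm]
    refine le_antisymm (hx.1 m) ?_
    rw [← lp.single_apply_ne p n z hm]
    exact hx.2 m

end LpSingle

/-! ### Interval preserving operators -/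

section IntervalPreserving

variable {X Y : Type*} [NormedAddCommGroup X] [NormedSpace ℝ X] [Lattice X]
  [NormedAddCommGroup Y] [NormedSpace ℝ Y] [Lattice Y]

/-- An operator between vector lattices is interval preserving if it is positive and maps each
order interval `[0, x]` onto `[0, T x]`. -/
def IntervalPreserving (T : X →L[ℝ] Y) : Prop :=
  ∀ x, 0 ≤ x → T '' Set.Icc 0 x = Set.Icc 0 (T x)

theorem IntervalPreserving.map_nonneg {T : X →L[ℝ] Y} (hT : IntervalPreserving T) {x : X}
    (hx : 0 ≤ x) : 0 ≤ T x :=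
  ((hT x hx).subset ⟨x, ⟨hx, le_rfl⟩, rfl⟩).1

variable [IsOrderedAddMonoid X] [IsOrderedAddMonoid Y]

theorem intervalPreserving_of_exists {T : X →L[ℝ] Y} (hT : ∀ x, 0 ≤ x → 0 ≤ T x)
    (h : ∀ x, 0 ≤ x → ∀ y ∈ Set.Icc 0 (T x), ∃ z ∈ Set.Icc 0 x, T z = y) :
    IntervalPreserving T := by
  refine fun x hx => Set.Subset.antisymm ?_ (h x hx)
  rintro _ ⟨z, hz, rfl⟩
  refine ⟨hT z hz.1, ?_⟩
  have := hT (x - z) (sub_nonneg.2 hz.2)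
  rwa [map_sub, sub_nonneg] at this

end IntervalPreserving

/-! ### Adjoints and transfer of property (d) -/

section DualMaps

attribute [local instance] dualLattice

variable {X Y : Type*}
  [NormedAddCommGroup X] [NormedSpace ℝ X] [Lattice X] [HasSolidNorm X] [IsOrderedAddMonoid X]
  [NormedAddCommGroup Y] [NormedSpace ℝ Y] [Lattice Y] [HasSolidNorm Y] [IsOrderedAddMonoid Y]

theorem dual_ext_of_nonneg {f g : StrongDual ℝ X} (h : ∀ x, 0 ≤ x → f x = g x) : f = g :=
  le_antisymm (fun x hx => (h x hx).le) (fun x hx => (h x hx).ge)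

/-- Modulus and meet are expressed through the positive part, so an adjoint that commutes with
`dualPos` commutes with both. -/
theorem dual_abs_eq (f : StrongDual ℝ X) : |f| = dualPos (f - -f) + -f := rfl

theorem dual_inf_eq (f g : StrongDual ℝ X) : f ⊓ g = f - dualPos (f - g) := rfl

/-- The adjoint of an interval preserving operator is a lattice homomorphism. -/
theorem IntervalPreserving.dualPos_comp {T : X →L[ℝ] Y} (hT : IntervalPreserving T)
    (f : StrongDual ℝ Y) : dualPos (f.comp T) = (dualPos f).comp T := by
  refine dual_ext_of_nonneg fun x hx => ?_
  -- Since `[0, T x] = T [0, x]`, both suprema run over the same set of values.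
  rw [ContinuousLinearMap.comp_apply, dualPos_apply_of_nonneg _ hx,
    dualPos_apply_of_nonneg _ (hT.map_nonneg hx), ← hT x hx, Set.image_image]
  rfl

theorem IntervalPreserving.abs_comp {T : X →L[ℝ] Y} (hT : IntervalPreserving T)
    (f : StrongDual ℝ Y) : |f.comp T| = |f|.comp T := by
  rw [dual_abs_eq, dual_abs_eq, ContinuousLinearMap.add_comp, ← hT.dualPos_comp]
  rfl

theorem IntervalPreserving.inf_comp {T : X →L[ℝ] Y} (hT : IntervalPreserving T)
    (f g : StrongDual ℝ Y) : f.comp T ⊓ g.comp T = (f ⊓ g).comp T := by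
  rw [dual_inf_eq, dual_inf_eq, ContinuousLinearMap.sub_comp, ← hT.dualPos_comp]
  rfl

theorem IntervalPreserving.disjoint_comp {T : X →L[ℝ] Y} (hT : IntervalPreserving T)
    {f g : StrongDual ℝ Y} (h : |f| ⊓ |g| = 0) : |f.comp T| ⊓ |g.comp T| = 0 := by
  rw [hT.abs_comp, hT.abs_comp, hT.inf_comp, h, ContinuousLinearMap.zero_comp]

theorem norm_dualPos_apply_le (f : StrongDual ℝ X) (x : X) : ‖dualPos f x‖ ≤ ‖f‖ * ‖x‖ := by
  have key : ∀ y : X, |y| ≤ |x| → 0 ≤ y → dualPosAux f y ≤ ‖f‖ * ‖x‖ := fun y hy hy0 =>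
    dualPosAux_le f hy0 fun z hz => (le_norm_mul_of_mem_Icc f hz).trans
      (mul_le_mul_of_nonneg_left (norm_le_norm_of_abs_le_abs hy) (norm_nonneg f))
  have hp := key x⁺ (by
    rw [abs_of_nonneg (posPart_nonneg x)]
    exact sup_le (le_abs_self x) (abs_nonneg x)) (posPart_nonneg x)
  have hn := key x⁻ (by
    rw [abs_of_nonneg (negPart_nonneg x)]
    exact sup_le (neg_le_abs x) (abs_nonneg x)) (negPart_nonneg x)
  have hp0 := dualPosAux_nonneg f (posPart_nonneg x)
  have hn0 := dualPosAux_nonneg f (negPart_nonneg x)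
  rw [dualPos_apply, Real.norm_eq_abs, abs_le]
  constructor <;> linarith

/-- From `|f| = (2f)⁺ - f` comes the crude constant `2 + 1`; any uniform bound suffices. -/
theorem norm_dual_abs_le (f : StrongDual ℝ X) : ‖|f|‖ ≤ 3 * ‖f‖ := by
  refine ContinuousLinearMap.opNorm_le_bound _ (by positivity) fun x => ?_
  have h1 := norm_dualPos_apply_le (f - -f) x
  have h2 : ‖f - -f‖ ≤ ‖f‖ + ‖f‖ := by simpa using norm_sub_le f (-f)
  have h3 := mul_le_mul_of_nonneg_right h2 (norm_nonneg x)
  have h4 : ‖|f| x‖ ≤ ‖dualPos (f - -f) x‖ + ‖f x‖ := by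
    rw [← norm_neg (f x)]
    exact norm_add_le (dualPos (f - -f) x) (-(f x))
  have h5 := f.le_opNorm x
  linarith

/-- Property (d) passes to the range of an interval preserving retraction. -/
theorem PropertyD.of_retraction {i : Y →L[ℝ] X} {π : X →L[ℝ] Y} (hπ : IntervalPreserving π)
    (h : ∀ y, π (i y) = y) (hX : PropertyD X) : PropertyD Y := by
  intro f hd hf
  rw [tendsto_toWeakDual_zero_iff] at hf ⊢
  have := hX (fun k => (f k).comp π) (fun m n hmn => hπ.disjoint_comp (hd hmn))
    (tendsto_toWeakDual_zero_iff.2 fun x => hf (π x))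
  rw [tendsto_toWeakDual_zero_iff] at this
  intro y
  simpa only [hπ.abs_comp, ContinuousLinearMap.comp_apply, h] using this (i y)

/-- Property (d) of a Banach lattice with an unconditional decomposition into bands is equivalent
to property (d) of all these bands. -/
theorem propertyD_iff_of_decomposition [CompleteSpace X] {Z : ℕ → Type*}
    [∀ n, NormedAddCommGroup (Z n)] [∀ n, NormedSpace ℝ (Z n)] [∀ n, Lattice (Z n)]
    [∀ n, HasSolidNorm (Z n)] [∀ n, IsOrderedAddMonoid (Z n)]
    {i : ∀ n, Z n →L[ℝ] X} {π : ∀ n, X →L[ℝ] Z n}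
    (hi : ∀ n, IntervalPreserving (i n)) (hπ : ∀ n, IntervalPreserving (π n))
    (h : ∀ n z, π n (i n z) = z) (hsum : ∀ x, HasSum (fun n => i n (π n x)) x) :
    PropertyD X ↔ ∀ n, PropertyD (Z n) := by
  refine ⟨fun hX n => hX.of_retraction (hπ n) (h n), fun hZ f hd hf => ?_⟩
  rw [tendsto_toWeakDual_zero_iff] at hf ⊢
  obtain ⟨C, hC⟩ := exists_norm_le_of_tendsto_apply hf
  refine fun x => tendsto_apply_of_hasSum
    (fun k => (norm_dual_abs_le (f k)).trans (mul_le_mul_of_nonneg_left (hC k) zero_le_three))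
    (hsum x) fun n => ?_
  have := hZ n (fun k => (f k).comp (i n)) (fun m n hmn => (hi _).disjoint_comp (hd hmn))
    (tendsto_toWeakDual_zero_iff.2 fun z => hf (i n z))
  rw [tendsto_toWeakDual_zero_iff] at this
  simpa only [(hi n).abs_comp, ContinuousLinearMap.comp_apply] using this (π n x)

end DualMaps

/-! ### Coordinate maps of the sums -/

section Sums

variable {E : ℕ → Type*} [∀ n, NormedAddCommGroup (E n)] [∀ n, NormedSpace ℝ (E n)]

/-- The `n`-th coordinate on an `ℓ_p`-sum. -/
noncomputable def lpCoord (p : ℝ≥0∞) [Fact (1 ≤ p)] (n : ℕ) : lp E p →L[ℝ] E n :=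
  LinearMap.mkContinuous
    { toFun := fun x => x n
      map_add' := fun _ _ => rfl
      map_smul' := fun _ _ => rfl } 1
    fun x => by
      rw [one_mul]
      exact lp.norm_apply_le_norm (zero_lt_one.trans_le Fact.out).ne' x n

theorem single_mem_c0Sum (n : ℕ) (z : E n) : lp.single ∞ n z ∈ c0Sum E := by
  rw [mem_c0Sum]
  refine tendsto_const_nhds.congr' ?_
  filter_upwards [eventually_gt_atTop n] with m hm
  rw [lp.single_apply_ne ∞ n z hm.ne', norm_zero]

/-- The `n`-th coordinate embedding into a `c_0`-sum. -/
noncomputable def c0Single (n : ℕ) : E n →L[ℝ] c0Sum E :=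
  (lp.singleContinuousLinearMap ℝ E ∞ n).codRestrict (c0Sum E) (single_mem_c0Sum n)

theorem coe_c0Single (n : ℕ) (z : E n) : (c0Single n z : lp E ∞) = lp.single ∞ n z := rfl

/-- The `n`-th coordinate on a `c_0`-sum. -/
noncomputable def c0Coord (n : ℕ) : c0Sum E →L[ℝ] E n := (lpCoord ∞ n).comp (c0Sum E).subtypeL

theorem c0Coord_apply (n : ℕ) (x : c0Sum E) : c0Coord n x = x.1 n := rfl

theorem hasSum_c0Single (x : c0Sum E) : HasSum (fun n => c0Single n (c0Coord n x)) x := by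
  refine Metric.tendsto_atTop.2 fun ε hε => ?_
  obtain ⟨N, hN⟩ := Metric.tendsto_atTop.1 (mem_c0Sum.1 x.2) (ε / 2) (half_pos hε)
  refine ⟨Finset.range N, fun s hs => ?_⟩
  rw [dist_comm, dist_eq_norm]
  -- A supremum of terms below `ε / 2` is only known to be at most `ε / 2`.
  refine lt_of_le_of_lt ?_ (half_lt_self hε)
  refine lp.norm_le_of_forall_le (half_pos hε).le fun m => ?_
  have hcoord : (∑ n ∈ s, c0Single n (c0Coord n x)).1 m = if m ∈ s then x.1 m else 0 := by
    rw [AddSubmonoidClass.coe_finsetSum, lp.coeFn_sum, Finset.sum_apply]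
    simp only [coe_c0Single, lp.single_apply, c0Coord_apply, Finset.sum_pi_single]
  change ‖x.1 m - (∑ n ∈ s, c0Single n (c0Coord n x)).1 m‖ ≤ ε / 2
  rw [hcoord]
  split_ifs with hm
  · simpa using (half_pos hε).le
  -- Indices outside `s` are at least `N`, because `s` contains `range N`.
  · have := hN m (not_lt.1 fun h => hm (hs (Finset.mem_range.2 h)))
    simpa using this.le

variable [∀ n, Lattice (E n)] [∀ n, HasSolidNorm (E n)] [∀ n, IsOrderedAddMonoid (E n)]

theorem intervalPreserving_single (p : ℝ≥0∞) [Fact (1 ≤ p)] (n : ℕ) :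
    IntervalPreserving (lp.singleContinuousLinearMap ℝ E p n) := by
  refine intervalPreserving_of_exists (fun z hz => lp.single_nonneg hz) fun z _ x hx => ?_
  refine ⟨x n, ⟨hx.1 n, ?_⟩, lp.eq_single_of_mem_Icc hx⟩
  rw [← lp.single_apply_self (E := E) p n z]
  exact hx.2 n

/-- An element of `[0, x n]` lifts to the vector supported at `n`, which stays below `x` because the
other coordinates of `x` are nonnegative. -/
theorem intervalPreserving_lpCoord (p : ℝ≥0∞) [Fact (1 ≤ p)] (n : ℕ) :
    IntervalPreserving (lpCoord (E := E) p n) :=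
  intervalPreserving_of_exists (fun _ hx => hx n) fun _ hx z hz =>
    ⟨lp.single p n z, ⟨lp.single_nonneg hz.1, lp.single_le_of_le_apply hx hz.2⟩,
      lp.single_apply_self p n z⟩

theorem intervalPreserving_c0Single (n : ℕ) : IntervalPreserving (c0Single (E := E) n) := by
  refine intervalPreserving_of_exists
    (fun z hz => lp.single_nonneg (p := ∞) hz) fun z _ x hx => ?_
  refine ⟨x.1 n, ⟨hx.1 n, ?_⟩, Subtype.ext (lp.eq_single_of_mem_Icc ⟨hx.1, hx.2⟩)⟩
  rw [← lp.single_apply_self (E := E) ∞ n z]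
  exact hx.2 n

theorem intervalPreserving_c0Coord (n : ℕ) : IntervalPreserving (c0Coord (E := E) n) :=
  intervalPreserving_of_exists (fun _ hx => hx n) fun _ hx z hz =>
    ⟨c0Single n z, ⟨lp.single_nonneg (p := ∞) hz.1, lp.single_le_of_le_apply (p := ∞) hx hz.2⟩,
      lp.single_apply_self ∞ n z⟩

theorem propertyD_c0Sum_iff [∀ n, CompleteSpace (E n)] :
    PropertyD (c0Sum E) ↔ ∀ n, PropertyD (E n) :=
  propertyD_iff_of_decomposition intervalPreserving_c0Single intervalPreserving_c0Coord
    (fun n z => lp.single_apply_self ∞ n z) hasSum_c0Single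

theorem propertyD_lp_iff [∀ n, CompleteSpace (E n)] (p : ℝ≥0∞) [Fact (1 ≤ p)] (hp : p ≠ ∞) :
    PropertyD (lp E p) ↔ ∀ n, PropertyD (E n) :=
  propertyD_iff_of_decomposition (intervalPreserving_single p) (intervalPreserving_lpCoord p)
    (fun n z => lp.single_apply_self p n z) fun x => lp.hasSum_single hp x

end Sums

theorem mainTheorem6
    (E : ℕ → Type*) [∀ n, NormedAddCommGroup (E n)] [∀ n, NormedSpace ℝ (E n)]
    [∀ n, Lattice (E n)] [∀ n, IsOrderedAddMonoid (E n)] [∀ n, IsOrderedModule ℝ (E n)]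
    [∀ n, HasSolidNorm (E n)] [∀ n, CompleteSpace (E n)]
    (F : Type*) [NormedAddCommGroup F] [NormedSpace ℝ F] [Lattice F] [IsOrderedAddMonoid F]
    [IsOrderedModule ℝ F] [HasSolidNorm F] [CompleteSpace F] :
    (PropertyD (c0Sum E) ↔ ∀ n, PropertyD (E n)) ∧
    (∀ (p : ℝ≥0∞) [Fact (1 ≤ p)], p ≠ ∞ → (PropertyD (lp E p) ↔ ∀ n, PropertyD (E n))) ∧
    List.TFAE
      [PropertyD F,
       PropertyD (c0Sum fun _ : ℕ => F),
       ∃ (p : ℝ≥0∞) (_ : Fact (1 ≤ p)), p ≠ ∞ ∧ PropertyD (lp (fun _ : ℕ => F) p),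
       ∀ (p : ℝ≥0∞) [Fact (1 ≤ p)], p ≠ ∞ → PropertyD (lp (fun _ : ℕ => F) p)] := by
  refine ⟨propertyD_c0Sum_iff, fun p _ hp => propertyD_lp_iff p hp, ?_⟩
  tfae_have 1 ↔ 2 := by rw [propertyD_c0Sum_iff, forall_const]
  tfae_have 1 → 4 := fun h p _ hp => (propertyD_lp_iff p hp).2 fun _ => h
  tfae_have 4 → 3 := fun h => ⟨1, ⟨le_rfl⟩, ENNReal.one_ne_top, h 1 ENNReal.one_ne_top⟩
  -- The family is constant, so any coordinate would do.
  tfae_have 3 → 1 := fun ⟨p, _, hp, h⟩ => (propertyD_lp_iff p hp).1 h 0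
  tfae_finish
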